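/- **Proposition 2.1.** Let $\alpha\in(0,2)$ and let $(\xi,\eta)$ be a symmetric $\alpha$-stable ($S\alpha S$) random vector in $\mathbb{R}^2$. An *integral representation* of $(\xi,\eta)$ is a triple $(f,g,\mu)$, where $(S,\mu)$ is a measure space and $f,g\in L^\alpha(S,\mu)$ are real functions, such that $$(\xi,\eta)\ \overset{d}{=}\ \Big(\int_S f(s)\,M(ds),\ \int_S g(s)\,M(ds)\Big)$$ for some $S\alpha S$ random measure $M$ on $S$ with control measure $\mu$. Here $M$ assigns to each measurable set $A$ with $\mu(A)<\infty$ a random variable $M(A)$ with $\mathbb{E}e^{i\theta M(A)}=e^{-\mu(A)|\theta|^\alpha}$, $\theta\in\mathbb{R}$, so that the values on finitely many disjoint sets are independent and $M$ is almost surely additive on disjoint sets; the stochastic integral of $f\in L^\alpha(S,\mu)$ is the limit in probability of the integrals $\sum_i a_iM(A_i)$ of simple functions $\sum_i a_i 1_{A_i}$ (with $\mu(A_i)<\infty$ and the $A_i$ disjoint) converging to $f$ in $L^\alpha(S,\mu)$. Put $$[\xi,\eta]_1^*=\int_S|f|^{\alpha-1}|g|\,d\mu,\qquad [\xi,\eta]_1=\int_S|f|^{\alpha-1}|g|\,d\mu+\int_S|g|^{\alpha-1}|f|\,d\mu,\qquad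 [\xi,\eta]_2=\int_S|fg|^{\alpha/2}\,d\mu,$$ as elements of $[0,\infty]$, with the conventions $0^{\alpha-1}=\infty$ if $\alpha<1$, $0^0=1$ and $\infty\cdot 0=0$. Then $[\xi,\eta]_1^*$, $[\xi,\eta]_1$ and $[\xi,\eta]_2$ do not depend on the representation: if $(f_1,g_1,\mu_1)$ and $(f_2,g_2,\mu_2)$, on possibly different spaces $S_1$ and $S_2$, are integral representations of the same vector $(\xi,\eta)$, then each of the three quantities has the same value in $[0,\infty]$ whether it is computed from $(f_1,g_1,\mu_1)$ or from $(f_2,g_2,\mu_2)$. -/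

import Mathlib

open MeasureTheory ProbabilityTheory Filter Topology
open scoped ENNReal

/-- `X` is a symmetric `α`-stable random variable with scale coefficient `σ`: its characteristic
function is `θ ↦ exp (-σ ^ α * |θ| ^ α)`. -/
def IsSymmStable {Ω : Type*} [MeasurableSpace Ω] (α σ : ℝ) (P : Measure Ω) (X : Ω → ℝ) : Prop :=
  ∀ θ : ℝ, ∫ ω, Complex.exp (Complex.I * ((θ * X ω : ℝ) : ℂ)) ∂P =
    ((Real.exp (-(σ ^ α * |θ| ^ α)) : ℝ) : ℂ)

/-- `M` is a symmetric `α`-stable random measure on `S` with control measure `μ`, defined on the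
probability space `(Ω, P)`. Only the values `M A` on measurable sets of finite `μ`-measure are
meaningful. Countable additivity (in probability, hence almost surely for the partial sums) follows
from the three last fields. -/
structure IsSymmStableRandomMeasure {S Ω : Type*} [MeasurableSpace S] [MeasurableSpace Ω]
    (α : ℝ) (μ : Measure S) (P : Measure Ω) (M : Set S → Ω → ℝ) : Prop where
  measurable : ∀ A : Set S, MeasurableSet A → μ A < ∞ → Measurable (M A)
  stable : ∀ A : Set S, MeasurableSet A → μ A < ∞ →
    IsSymmStable α ((μ A).toReal ^ (1 / α)) P (M A)
  indep : ∀ (n : ℕ) (A : Fin n → Set S), (∀ i, MeasurableSet (A i)) → (∀ i, μ (A i) < ∞) →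
    Pairwise (fun i j => Disjoint (A i) (A j)) → iIndepFun (fun i => M (A i)) P
  additive : ∀ A B : Set S, MeasurableSet A → MeasurableSet B → μ A < ∞ → μ B < ∞ →
    Disjoint A B → ∀ᵐ ω ∂P, M (A ∪ B) ω = M A ω + M B ω

/-- The integral `∑ x, x * M {φ = x}` of a simple function `φ`. (The value `x = 0` contributes
nothing, whatever `M {φ = 0}` is.) -/
noncomputable def simpleStableIntegral {S Ω : Type*} [MeasurableSpace S]
    (M : Set S → Ω → ℝ) (φ : SimpleFunc S ℝ) (ω : Ω) : ℝ :=
  ∑ x ∈ φ.range, x * M (φ ⁻¹' {x}) ω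

/-- `X` is (a version of) the stochastic integral `∫ f dM`: a limit in probability of the integrals
of simple functions, each supported on a set of finite measure, that converge to `f` in
`L^α(S, μ)`. -/
def IsStableIntegral {S Ω : Type*} [MeasurableSpace S] [MeasurableSpace Ω]
    (α : ℝ) (μ : Measure S) (P : Measure Ω) (M : Set S → Ω → ℝ) (f : S → ℝ) (X : Ω → ℝ) : Prop :=
  ∃ φ : ℕ → SimpleFunc S ℝ,
    (∀ n, ∀ x : ℝ, x ≠ 0 → μ (φ n ⁻¹' {x}) < ∞) ∧
    Tendsto (fun n => eLpNorm (fun s => φ n s - f s) (ENNReal.ofReal α) μ) atTop (𝓝 0) ∧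
    TendstoInMeasure P (fun n => simpleStableIntegral M (φ n)) atTop X

universe u v w u₀ u₁ u₂ w₁ w₂

/-- `(f, g, μ)` is an integral representation of the random vector `(ξ, η)`:
`f, g ∈ L^α(S, μ)`, and `(ξ, η)` has the law of `(∫ f dM, ∫ g dM)` for a symmetric `α`-stable random
measure `M` with control measure `μ`, defined on some probability space `(Ω', P')`. -/
def IsIntegralRepresentation {Ω : Type u} [MeasurableSpace Ω] {S : Type v} [MeasurableSpace S]
    (α : ℝ) (P : Measure Ω) (ξ η : Ω → ℝ) (f g : S → ℝ) (μ : Measure S) : Prop :=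
  MemLp f (ENNReal.ofReal α) μ ∧ MemLp g (ENNReal.ofReal α) μ ∧
    ∃ (Ω' : Type w) (_ : MeasurableSpace Ω') (P' : Measure Ω') (M : Set S → Ω' → ℝ)
      (X Y : Ω' → ℝ),
      IsProbabilityMeasure P' ∧ IsSymmStableRandomMeasure α μ P' M ∧
      IsStableIntegral α μ P' M f X ∧ IsStableIntegral α μ P' M g Y ∧
      IdentDistrib (fun ω => (ξ ω, η ω)) (fun ω => (X ω, Y ω)) P P'

/-- The quantity `[ξ, η]₁* = ∫ |f| ^ (α - 1) |g| dμ ∈ [0, ∞]`, computed from `(f, g, μ)`.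
Conventions where `f = 0`: `0 ^ (α - 1) = ∞` for `α < 1`, `0 ^ 0 = 1`, and `∞ * 0 = 0`. -/
noncomputable def depOneStar {S : Type*} [MeasurableSpace S]
    (α : ℝ) (f g : S → ℝ) (μ : Measure S) : ℝ≥0∞ :=
  ∫⁻ s, ‖f s‖ₑ ^ (α - 1) * ‖g s‖ₑ ∂μ

/-- The quantity `[ξ, η]₁ = [ξ, η]₁* + [η, ξ]₁*`, computed from `(f, g, μ)`. -/
noncomputable def depOne {S : Type*} [MeasurableSpace S]
    (α : ℝ) (f g : S → ℝ) (μ : Measure S) : ℝ≥0∞ :=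
  depOneStar α f g μ + depOneStar α g f μ

/-- The quantity `[ξ, η]₂ = ∫ |f g| ^ (α / 2) dμ ∈ [0, ∞]`, computed from `(f, g, μ)`. -/
noncomputable def depTwo {S : Type*} [MeasurableSpace S]
    (α : ℝ) (f g : S → ℝ) (μ : Measure S) : ℝ≥0∞ :=
  ∫⁻ s, ‖f s * g s‖ₑ ^ (α / 2) ∂μ

/-! All three quantities are integrals of `h (f, g)` with `h` on the plane vanishing at 0 and
absolutely homogeneous of degree `α`. The characteristic function of the vector at `(a, b)` is `exp
(-∫ |a f + b g| ^ α dμ)` (`IsSymmStableRandomMeasure.integral_exp_add`), so the vector fixes the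
scale function `(a, b) ↦ ∫ |a x + b y| ^ α dν`, where `ν` is the image of `μ` under `(f, g)`.

It remains to recover `∫ h dν` from the scale function (`lintegral_homogeneous_eq`). Spreading `ν`
along rays with weight `|r| ^ (-1 - α) dr` gives a symmetric Lévy measure `Λ`, and `∫ (1 - cos L)
dΛ` is a finite constant times `∫ |L| ^ α dν`. These integrals determine `Λ` off the origin: the
finite symmetric measure `(1 - cos L) Λ` has a Fourier transform expressible through them
(`restrict_eq_of_lintegral_one_sub_cos_eq`), and countably many `L` reach every nonzero point.
Finally, integrating `h` over the annulus `1 ≤ ‖w‖ ≤ 2` against `Λ` gives `∫ h dν` times a constant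
in `(0, ∞)`, so infinite values are covered too. -/

/-! ### Continuity of the `α`-th moment under `L^α` convergence -/

theorem ENNReal.tendsto_of_le_add {a d : ℕ → ℝ≥0∞} {b : ℝ≥0∞} (h₁ : ∀ n, a n ≤ b + d n)
    (h₂ : ∀ n, b ≤ a n + d n) (hd : Tendsto d atTop (𝓝 0)) : Tendsto a atTop (𝓝 b) := by
  have hl : Tendsto (fun n => b - d n) atTop (𝓝 b) := by
    simpa using ENNReal.Tendsto.sub (tendsto_const_nhds (x := b)) hd (Or.inr ENNReal.zero_ne_top)
  have hr : Tendsto (fun n => b + d n) atTop (𝓝 b) := by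
    simpa using (tendsto_const_nhds (x := b)).add hd
  exact tendsto_of_tendsto_of_tendsto_of_le_of_le hl hr
    (fun n => tsub_le_iff_right.2 (h₂ n)) h₁

theorem eLpNorm_ofReal_rpow {S : Type*} [MeasurableSpace S] {α : ℝ} (hα : 0 < α) {μ : Measure S}
    (u : S → ℝ) : eLpNorm u (ENNReal.ofReal α) μ ^ α = ∫⁻ s, ‖u s‖ₑ ^ α ∂μ := by
  rw [eLpNorm_eq_lintegral_rpow_enorm_toReal (by simpa using hα) ENNReal.ofReal_ne_top,
    ENNReal.toReal_ofReal hα.le, ← ENNReal.rpow_mul, one_div, inv_mul_cancel₀ hα.ne',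
    ENNReal.rpow_one]

theorem tendsto_ennreal_rpow {α : ℝ} {a : ℕ → ℝ≥0∞} {b : ℝ≥0∞}
    (h : Tendsto a atTop (𝓝 b)) : Tendsto (fun n => a n ^ α) atTop (𝓝 (b ^ α)) :=
  (ENNReal.continuous_rpow_const.tendsto b).comp h

/-- The functional `u ↦ ∫ |u| ^ α` is continuous along `L^α`-convergent sequences, for all
`α > 0`. -/
theorem tendsto_lintegral_enorm_rpow {S : Type*} [MeasurableSpace S] {α : ℝ} (hα : 0 < α)
    {μ : Measure S} {u : ℕ → S → ℝ} {v : S → ℝ} (hu : ∀ n, AEStronglyMeasurable (u n) μ)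
    (hv : AEStronglyMeasurable v μ)
    (h : Tendsto (fun n => eLpNorm (u n - v) (ENNReal.ofReal α) μ) atTop (𝓝 0)) :
    Tendsto (fun n => ∫⁻ s, ‖u n s‖ₑ ^ α ∂μ) atTop (𝓝 (∫⁻ s, ‖v s‖ₑ ^ α ∂μ)) := by
  -- For `α ≤ 1` the functional `∫ |u| ^ α` is itself subadditive; for `α ≥ 1` Minkowski's
  -- inequality applies to its root.
  rcases le_total α 1 with h1 | h1
  · have key : ∀ x y z : S → ℝ, AEStronglyMeasurable y μ → (∀ s, ‖x s‖ₑ ≤ ‖y s‖ₑ + ‖z s‖ₑ) →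
        ∫⁻ s, ‖x s‖ₑ ^ α ∂μ ≤ ∫⁻ s, ‖y s‖ₑ ^ α ∂μ + ∫⁻ s, ‖z s‖ₑ ^ α ∂μ := by
      intro x y z hy hle
      rw [← lintegral_add_left' (hy.enorm.pow_const α)]
      exact lintegral_mono fun s => (ENNReal.rpow_le_rpow (hle s) hα.le).trans
        (ENNReal.rpow_add_le_add_rpow _ _ hα.le h1)
    refine ENNReal.tendsto_of_le_add (d := fun n => ∫⁻ s, ‖(u n - v) s‖ₑ ^ α ∂μ)
      (fun n => key _ _ _ hv fun s => ?_) (fun n => key _ _ _ (hu n) fun s => ?_) ?_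
    · simpa using enorm_add_le (v s) (u n s - v s)
    · simpa using enorm_sub_le (a := u n s) (b := u n s - v s)
    · have := tendsto_ennreal_rpow (α := α) h
      simpa only [eLpNorm_ofReal_rpow hα, ENNReal.zero_rpow_of_pos hα] using this
  · have h1' : (1 : ℝ≥0∞) ≤ ENNReal.ofReal α := by simpa using h1
    have : Tendsto (fun n => eLpNorm (u n) (ENNReal.ofReal α) μ) atTop
        (𝓝 (eLpNorm v (ENNReal.ofReal α) μ)) := by
      refine ENNReal.tendsto_of_le_add (fun n => ?_) (fun n => ?_) h
      · simpa using eLpNorm_add_le hv ((hu n).sub hv) h1'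
      · simpa using eLpNorm_sub_le (hu n) ((hu n).sub hv) h1'
    simpa only [eLpNorm_ofReal_rpow hα] using tendsto_ennreal_rpow (α := α) this

/-! ### Characteristic functions of stable integrals -/

section RandomMeasure

variable {S Ω : Type*} [MeasurableSpace S] [MeasurableSpace Ω] {α : ℝ} {μ : Measure S}
  {P : Measure Ω} {M : Set S → Ω → ℝ}

theorem IsSymmStableRandomMeasure.ae_empty (hM : IsSymmStableRandomMeasure α μ P M) :
    ∀ᵐ ω ∂P, M ∅ ω = 0 := by
  have := hM.additive ∅ ∅ MeasurableSet.empty MeasurableSet.empty (by simp) (by simp) (by simp)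
  filter_upwards [this] with ω hω
  simpa using hω

theorem IsSymmStableRandomMeasure.ae_biUnion (hM : IsSymmStableRandomMeasure α μ P M)
    {ι : Type*} (T : Finset ι) (A : ι → Set S) (hA : ∀ i ∈ T, MeasurableSet (A i))
    (hμ : ∀ i ∈ T, μ (A i) < ∞) (hd : (T : Set ι).PairwiseDisjoint A) :
    ∀ᵐ ω ∂P, M (⋃ i ∈ T, A i) ω = ∑ i ∈ T, M (A i) ω := by
  classical
  induction T using Finset.induction_on with
  | empty => simpa using hM.ae_empty
  | insert a T ha ih =>
    have ih' := ih (fun i hi => hA i (Finset.mem_insert_of_mem hi))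
      (fun i hi => hμ i (Finset.mem_insert_of_mem hi))
      (hd.subset (by simp))
    have hadd := hM.additive (A a) (⋃ i ∈ T, A i) (hA a (Finset.mem_insert_self _ _))
      (Finset.measurableSet_biUnion _ fun i hi => hA i (Finset.mem_insert_of_mem hi))
      (hμ a (Finset.mem_insert_self _ _))
      (measure_biUnion_lt_top T.finite_toSet fun i hi => hμ i (Finset.mem_insert_of_mem hi))
      (by
        rw [Set.disjoint_iUnion₂_right]
        intro i hi
        exact hd (by simp) (by simp [hi]) (by rintro rfl; exact ha hi))
    filter_upwards [ih', hadd] with ω h1 h2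
    rw [Finset.set_biUnion_insert, h2, h1, Finset.sum_insert ha]

/-- The integral may be computed on any finer partition, which is what makes it linear: two simple
functions are compared on their common refinement. -/
theorem IsSymmStableRandomMeasure.simpleStableIntegral_map
    (hM : IsSymmStableRandomMeasure α μ P M) {β : Type*} (ρ : SimpleFunc S β) (k : β → ℝ)
    (hk : ∀ p, k p ≠ 0 → μ (ρ ⁻¹' {p}) < ∞) :
    ∀ᵐ ω ∂P, simpleStableIntegral M (ρ.map k) ω = ∑ p ∈ ρ.range, k p * M (ρ ⁻¹' {p}) ω := by
  classical
  have hx : ∀ x ∈ (ρ.map k).range, ∀ᵐ ω ∂P, x * M (ρ.map k ⁻¹' {x}) ω =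
      ∑ p ∈ ρ.range with k p = x, k p * M (ρ ⁻¹' {p}) ω := by
    intro x _
    -- The fibre over 0 may have infinite measure, where additivity says nothing; the factor 0
    -- removes it.
    rcases eq_or_ne x 0 with rfl | hx0
    · refine ae_of_all _ fun ω => ?_
      rw [zero_mul, Finset.sum_eq_zero]
      intro p hp
      rw [(Finset.mem_filter.1 hp).2, zero_mul]
    · have hset : ρ.map k ⁻¹' {x} = ⋃ p ∈ ρ.range.filter (fun p => k p = x), ρ ⁻¹' {p} := by
        ext s
        simp
      have := hM.ae_biUnion (ρ.range.filter (fun p => k p = x)) (fun p => ρ ⁻¹' {p})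
        (fun p _ => ρ.measurableSet_fiber p)
        (fun p hp => hk p (by rw [(Finset.mem_filter.1 hp).2]; exact hx0))
        (fun p _ q _ hpq => Disjoint.preimage _ (by simpa using hpq))
      filter_upwards [this] with ω hω
      rw [hset, hω, Finset.mul_sum]
      exact Finset.sum_congr rfl fun p hp => by rw [(Finset.mem_filter.1 hp).2]
  filter_upwards [(Finset.eventually_all (ρ.map k).range).2 hx] with ω hω
  rw [simpleStableIntegral, Finset.sum_congr rfl hω]
  exact Finset.sum_fiberwise_of_maps_to (fun p hp => by
    rw [SimpleFunc.range_map]; exact Finset.mem_image_of_mem _ hp) _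

theorem IsSymmStableRandomMeasure.measurable_simpleStableIntegral
    (hM : IsSymmStableRandomMeasure α μ P M) (χ : SimpleFunc S ℝ)
    (hχ : ∀ x : ℝ, x ≠ 0 → μ (χ ⁻¹' {x}) < ∞) : Measurable (simpleStableIntegral M χ) := by
  refine Finset.measurable_fun_sum _ fun x _ => ?_
  rcases eq_or_ne x 0 with rfl | hx
  · simp
  · exact (hM.measurable _ (χ.measurableSet_fiber x) (hχ x hx)).const_mul x

/-- The values of `M` on distinct fibres are independent, so the characteristic function factors and
the exponents add up to `∫ |χ| ^ α`. -/
theorem IsSymmStableRandomMeasure.integral_exp_simpleStableIntegral (hα : 0 < α)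
    (hM : IsSymmStableRandomMeasure α μ P M) (χ : SimpleFunc S ℝ)
    (hχ : ∀ x : ℝ, x ≠ 0 → μ (χ ⁻¹' {x}) < ∞) :
    ∫ ω, Complex.exp (Complex.I * (simpleStableIntegral M χ ω : ℝ)) ∂P =
      ((Real.exp (-(∫⁻ s, ‖χ s‖ₑ ^ α ∂μ).toReal) : ℝ) : ℂ) := by
  classical
  set T := χ.range.filter (· ≠ 0) with hT
  have hT0 : ∀ x : T, (x : ℝ) ≠ 0 := fun x => (Finset.mem_filter.1 x.2).2
  have hsum : ∀ ω, simpleStableIntegral M χ ω = ∑ x : T, (x : ℝ) * M (χ ⁻¹' {(x : ℝ)}) ω := by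
    intro ω
    rw [simpleStableIntegral, Finset.sum_coe_sort T (fun x => x * M (χ ⁻¹' {x}) ω), hT,
      Finset.sum_filter]
    exact Finset.sum_congr rfl fun x _ => by split_ifs with h <;> simp_all
  have hmeas : ∀ x : T, Measurable (M (χ ⁻¹' {(x : ℝ)})) := fun x =>
    hM.measurable _ (χ.measurableSet_fiber _) (hχ _ (hT0 x))
  have hind : iIndepFun (fun x : T => M (χ ⁻¹' {(x : ℝ)})) P := by
    have e := T.equivFin
    have := hM.indep T.card (fun i => χ ⁻¹' {((e.symm i : T) : ℝ)})
      (fun i => χ.measurableSet_fiber _) (fun i => hχ _ (hT0 _))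
      (fun i j hij => Disjoint.preimage _ (by
        simpa [Subtype.ext_iff] using fun h => hij (e.symm.injective (Subtype.ext h))))
    have h2 := this.precomp e.injective
    simpa using h2
  have hind' : iIndepFun (fun (x : T) ω =>
      Complex.exp (Complex.I * (((x : ℝ) * M (χ ⁻¹' {(x : ℝ)}) ω : ℝ) : ℂ))) P :=
    hind.comp (fun (x : T) (y : ℝ) => Complex.exp (Complex.I * (((x : ℝ) * y : ℝ) : ℂ)))
      (fun x => by fun_prop)
  have hexp : ∀ ω, Complex.exp (Complex.I * (simpleStableIntegral M χ ω : ℝ)) =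
      ∏ x : T, Complex.exp (Complex.I * (((x : ℝ) * M (χ ⁻¹' {(x : ℝ)}) ω : ℝ) : ℂ)) := by
    intro ω
    rw [hsum, ← Complex.exp_sum, Complex.ofReal_sum, Finset.mul_sum]
  simp_rw [hexp]
  rw [hind'.integral_fun_prod_eq_prod_integral fun x => by
    have := hmeas x
    exact Measurable.aestronglyMeasurable (by fun_prop)]
  have hone : ∀ x : T, ∫ ω, Complex.exp (Complex.I * (((x : ℝ) * M (χ ⁻¹' {(x : ℝ)}) ω : ℝ) : ℂ)) ∂P =
      ((Real.exp (-((μ (χ ⁻¹' {(x : ℝ)})).toReal * |(x : ℝ)| ^ α)) : ℝ) : ℂ) := by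
    intro x
    rw [hM.stable _ (χ.measurableSet_fiber _) (hχ _ (hT0 x)) x, ← Real.rpow_mul (by positivity),
      one_div, inv_mul_cancel₀ hα.ne', Real.rpow_one]
  simp_rw [hone]
  rw [← Complex.ofReal_prod, ← Real.exp_sum, Finset.sum_neg_distrib]
  congr 4
  have hl : ∫⁻ s, ‖χ s‖ₑ ^ α ∂μ = ∑ x ∈ χ.range, ‖x‖ₑ ^ α * μ (χ ⁻¹' {x}) := by
    rw [← SimpleFunc.map_lintegral, ← SimpleFunc.lintegral_eq_lintegral]
    rfl
  rw [hl, Finset.sum_coe_sort T (fun x => (μ (χ ⁻¹' {x})).toReal * |x| ^ α), hT,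
    ENNReal.toReal_sum, Finset.sum_filter]
  · refine Finset.sum_congr rfl fun x _ => ?_
    rw [ENNReal.toReal_mul, ← ENNReal.toReal_rpow, toReal_enorm, Real.norm_eq_abs, mul_comm]
    split_ifs with h
    · rfl
    · rw [not_not.1 h]; simp [Real.zero_rpow hα.ne']
  · intro x _
    rcases eq_or_ne x 0 with rfl | hx
    · simp [ENNReal.zero_rpow_of_pos hα]
    · exact ENNReal.mul_ne_top (ENNReal.rpow_ne_top_of_nonneg hα.le enorm_ne_top) (hχ x hx).ne

theorem IsSymmStableRandomMeasure.integral_exp_add (hα : 0 < α) [IsProbabilityMeasure P]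
    (hM : IsSymmStableRandomMeasure α μ P M) {f g : S → ℝ} {X Y : Ω → ℝ}
    (hf : AEStronglyMeasurable f μ) (hg : AEStronglyMeasurable g μ)
    (hfin : ∀ a b : ℝ, ∫⁻ s, ‖a * f s + b * g s‖ₑ ^ α ∂μ ≠ ∞)
    (hX : IsStableIntegral α μ P M f X) (hY : IsStableIntegral α μ P M g Y) (a b : ℝ) :
    ∫ ω, Complex.exp (Complex.I * ((a * X ω + b * Y ω : ℝ) : ℂ)) ∂P =
      ((Real.exp (-(∫⁻ s, ‖a * f s + b * g s‖ₑ ^ α ∂μ).toReal) : ℝ) : ℂ) := by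
  obtain ⟨φ, hφ, hφf, hφX⟩ := hX
  obtain ⟨ψ, hψ, hψg, hψY⟩ := hY
  set ρ : ℕ → SimpleFunc S (ℝ × ℝ) := fun n => (φ n).pair (ψ n)
  have hρ : ∀ n p, p ≠ 0 → μ (ρ n ⁻¹' {p}) < ∞ := by
    intro n p hp
    have hset : ρ n ⁻¹' {p} = φ n ⁻¹' {p.1} ∩ ψ n ⁻¹' {p.2} := by
      ext s
      simp [ρ, Prod.ext_iff]
    rw [hset]
    by_cases h1 : p.1 = 0
    · have h2 : p.2 ≠ 0 := fun h2 => hp (Prod.ext h1 h2)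
      exact (measure_mono Set.inter_subset_right).trans_lt (hψ n _ h2)
    · exact (measure_mono Set.inter_subset_left).trans_lt (hφ n _ h1)
  set χ : ℕ → SimpleFunc S ℝ := fun n => (ρ n).map fun p => a * p.1 + b * p.2
  have hχ : ∀ n x, x ≠ 0 → μ (χ n ⁻¹' {x}) < ∞ := by
    intro n x hx
    have hset : χ n ⁻¹' {x} ⊆ ⋃ p ∈ (ρ n).range.filter (· ≠ 0), ρ n ⁻¹' {p} := by
      intro s hs
      have hs' : a * (ρ n s).1 + b * (ρ n s).2 = x := hs
      simp only [Set.mem_iUnion, Finset.mem_filter]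
      refine ⟨ρ n s, ⟨SimpleFunc.mem_range_self _ _, fun h0 => hx ?_⟩, rfl⟩
      rw [← hs', h0]; simp
    exact (measure_mono hset).trans_lt (measure_biUnion_lt_top (Finset.finite_toSet _)
      fun p hp => hρ n p (Finset.mem_filter.1 hp).2)
  have hlin : ∀ n, ∀ᵐ ω ∂P, simpleStableIntegral M (χ n) ω =
      a * simpleStableIntegral M (φ n) ω + b * simpleStableIntegral M (ψ n) ω := by
    intro n
    have h1 := hM.simpleStableIntegral_map (ρ n) (fun p => a * p.1 + b * p.2)
      (fun p hp => hρ n p (by rintro rfl; simp at hp))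
    have h2 := hM.simpleStableIntegral_map (ρ n) Prod.fst
      (fun p hp => hρ n p (by rintro rfl; simp at hp))
    have h3 := hM.simpleStableIntegral_map (ρ n) Prod.snd
      (fun p hp => hρ n p (by rintro rfl; simp at hp))
    filter_upwards [h1, h2, h3] with ω h1 h2 h3
    have e2 : (ρ n).map Prod.fst = φ n := SimpleFunc.map_fst_pair _ _
    have e3 : (ρ n).map Prod.snd = ψ n := SimpleFunc.map_snd_pair _ _
    rw [e2] at h2
    rw [e3] at h3
    rw [h1, h2, h3, Finset.mul_sum, Finset.mul_sum, ← Finset.sum_add_distrib]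
    exact Finset.sum_congr rfl fun p _ => by ring
  have hnorm : Tendsto (fun n => eLpNorm (⇑(χ n) - fun s => a * f s + b * g s)
      (ENNReal.ofReal α) μ) atTop (𝓝 0) := by
    -- For `α < 1` the triangle inequality holds only up to the constant `LpAddConst`.
    have hle : ∀ n, eLpNorm (⇑(χ n) - fun s => a * f s + b * g s) (ENNReal.ofReal α) μ ≤
        (ENNReal.ofReal α).LpAddConst *
          (‖a‖ₑ * eLpNorm (fun s => φ n s - f s) (ENNReal.ofReal α) μ +
            ‖b‖ₑ * eLpNorm (fun s => ψ n s - g s) (ENNReal.ofReal α) μ) := by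
      intro n
      have h1 : AEStronglyMeasurable (fun s => φ n s - f s) μ :=
        (φ n).aestronglyMeasurable.sub hf
      have h2 : AEStronglyMeasurable (fun s => ψ n s - g s) μ :=
        (ψ n).aestronglyMeasurable.sub hg
      have e : (⇑(χ n) - fun s => a * f s + b * g s) =
          a • (fun s => φ n s - f s) + b • (fun s => ψ n s - g s) := by
        ext s
        simp [χ, ρ]
        ring
      rw [e, ← eLpNorm_const_smul, ← eLpNorm_const_smul]
      exact eLpNorm_add_le' (h1.const_smul a) (h2.const_smul b) _
    refine tendsto_of_tendsto_of_tendsto_of_le_of_le tendsto_const_nhds ?_ (fun _ => zero_le) hle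
    have h1 := ENNReal.Tendsto.const_mul hφf (a := ‖a‖ₑ) (Or.inr enorm_ne_top)
    have h2 := ENNReal.Tendsto.const_mul hψg (a := ‖b‖ₑ) (Or.inr enorm_ne_top)
    have := ENNReal.Tendsto.const_mul (h1.add h2) (a := (ENNReal.ofReal α).LpAddConst)
      (Or.inr (ENNReal.LpAddConst_lt_top _).ne)
    simpa using this
  have hlim := tendsto_lintegral_enorm_rpow hα (fun n => (χ n).aestronglyMeasurable)
    ((hf.const_mul a).add (hg.const_mul b)) hnorm
  -- Two successive extractions give one subsequence along which both integrals converge almost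
  -- surely.
  obtain ⟨ns, hns, hnsX⟩ := hφX.exists_seq_tendsto_ae
  obtain ⟨ms, hms, hmsY⟩ := (hψY.comp hns.tendsto_atTop).exists_seq_tendsto_ae
  set ks : ℕ → ℕ := fun i => ns (ms i)
  have hks : Tendsto ks atTop atTop := hns.tendsto_atTop.comp hms.tendsto_atTop
  have hleft : Tendsto (fun i => ∫ ω, Complex.exp (Complex.I *
      (simpleStableIntegral M (χ (ks i)) ω : ℝ)) ∂P) atTop
      (𝓝 (∫ ω, Complex.exp (Complex.I * ((a * X ω + b * Y ω : ℝ) : ℂ)) ∂P)) := by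
    refine tendsto_integral_of_dominated_convergence (fun _ => 1) (fun i => ?_)
      (integrable_const 1) (fun i => ae_of_all _ fun ω => ?_) ?_
    · have := hM.measurable_simpleStableIntegral (χ (ks i)) (hχ _)
      exact Measurable.aestronglyMeasurable (by fun_prop)
    · rw [mul_comm, Complex.norm_exp_ofReal_mul_I]
    · filter_upwards [hnsX, hmsY, ae_all_iff.2 hlin] with ω h1 h2 h3
      have h1' : Tendsto (fun i => simpleStableIntegral M (φ (ks i)) ω) atTop (𝓝 (X ω)) :=
        h1.comp hms.tendsto_atTop
      have h2' : Tendsto (fun i => simpleStableIntegral M (ψ (ks i)) ω) atTop (𝓝 (Y ω)) := h2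
      simp_rw [h3]
      have hc : Continuous fun x : ℝ => Complex.exp (Complex.I * (x : ℂ)) := by fun_prop
      exact (hc.tendsto _).comp ((h1'.const_mul a).add (h2'.const_mul b))
  refine tendsto_nhds_unique hleft ?_
  simp_rw [hM.integral_exp_simpleStableIntegral hα _ (hχ _)]
  -- Finiteness of the limit is needed here, since `toReal` is not continuous at `∞`.
  have hc : Continuous fun x : ℝ => ((Real.exp (-x) : ℝ) : ℂ) := by fun_prop
  exact (hc.tendsto _).comp ((ENNReal.tendsto_toReal (hfin a b)).comp (hlim.comp hks))

end RandomMeasure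

/-! ### The scale function of a representation -/

theorem lintegral_enorm_add_rpow_ne_top {S : Type*} [MeasurableSpace S] {α : ℝ} (hα : 0 < α)
    {μ : Measure S} {f g : S → ℝ} (hf : MemLp f (ENNReal.ofReal α) μ)
    (hg : MemLp g (ENNReal.ofReal α) μ) (a b : ℝ) :
    ∫⁻ s, ‖a * f s + b * g s‖ₑ ^ α ∂μ ≠ ∞ := by
  have := ((hf.const_mul a).add (hg.const_mul b)).eLpNorm_ne_top
  rw [← eLpNorm_ofReal_rpow hα (fun s => a * f s + b * g s)]
  exact ENNReal.rpow_ne_top_of_nonneg hα.le this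

theorem IsIntegralRepresentation.integral_exp {Ω : Type*} [MeasurableSpace Ω] {S : Type*}
    [MeasurableSpace S] {α : ℝ} (hα : 0 < α) {P : Measure Ω} {ξ η : Ω → ℝ} {f g : S → ℝ}
    {μ : Measure S} (h : IsIntegralRepresentation α P ξ η f g μ) (a b : ℝ) :
    ∫ ω, Complex.exp (Complex.I * ((a * ξ ω + b * η ω : ℝ) : ℂ)) ∂P =
      ((Real.exp (-(∫⁻ s, ‖a * f s + b * g s‖ₑ ^ α ∂μ).toReal) : ℝ) : ℂ) := by
  obtain ⟨hf, hg, Ω', _, P', M, X, Y, _, hM, hX, hY, hd⟩ := h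
  rw [← hM.integral_exp_add hα hf.1 hg.1 (lintegral_enorm_add_rpow_ne_top hα hf hg) hX hY a b]
  have hm : Measurable fun p : ℝ × ℝ => Complex.exp (Complex.I * ((a * p.1 + b * p.2 : ℝ) : ℂ)) := by
    fun_prop
  exact (hd.comp hm).integral_eq

/-- Two integral representations of the same vector have the same scale function. -/
theorem IsIntegralRepresentation.lintegral_eq {Ω : Type*} [MeasurableSpace Ω] {S₁ S₂ : Type*}
    [MeasurableSpace S₁] [MeasurableSpace S₂] {α : ℝ} (hα : 0 < α) {P : Measure Ω} {ξ η : Ω → ℝ}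
    {f₁ g₁ : S₁ → ℝ} {μ₁ : Measure S₁} {f₂ g₂ : S₂ → ℝ} {μ₂ : Measure S₂}
    (h₁ : IsIntegralRepresentation α P ξ η f₁ g₁ μ₁)
    (h₂ : IsIntegralRepresentation α P ξ η f₂ g₂ μ₂) (a b : ℝ) :
    ∫⁻ s, ‖a * f₁ s + b * g₁ s‖ₑ ^ α ∂μ₁ = ∫⁻ s, ‖a * f₂ s + b * g₂ s‖ₑ ^ α ∂μ₂ := by
  have h := (h₁.integral_exp hα a b).symm.trans (h₂.integral_exp hα a b)
  rw [Complex.ofReal_inj, Real.exp_eq_exp, neg_inj] at h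
  exact (ENNReal.toReal_eq_toReal_iff' (lintegral_enorm_add_rpow_ne_top hα h₁.1 h₁.2.1 a b)
    (lintegral_enorm_add_rpow_ne_top hα h₂.1 h₂.2.1 a b)).1 h

/-! ### Symmetric measures determined by integrals of `1 - cos` -/

section SymmetricMeasure

variable {E : Type*} [NormedAddCommGroup E] [NormedSpace ℝ E] [MeasurableSpace E] [BorelSpace E]

theorem measurable_ofReal_one_sub_cos (L : StrongDual ℝ E) :
    Measurable fun w => ENNReal.ofReal (1 - Real.cos (L w)) := by fun_prop

/-- Product-to-sum for cosines, arranged without subtraction so that it can be integrated in `ℝ≥0∞`.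
-/
theorem ofReal_one_sub_cos_mul (x y : ℝ) :
    2 * (ENNReal.ofReal (1 - Real.cos x) * ENNReal.ofReal (1 - Real.cos y)) +
        ENNReal.ofReal (1 - Real.cos (x + y)) + ENNReal.ofReal (1 - Real.cos (x - y)) =
      2 * ENNReal.ofReal (1 - Real.cos x) + 2 * ENNReal.ofReal (1 - Real.cos y) := by
  have hc : ∀ z : ℝ, 0 ≤ 1 - Real.cos z := fun z => by linarith [Real.cos_le_one z]
  have h2 : (2 : ℝ≥0∞) = ENNReal.ofReal 2 := by simp
  rw [h2, ← ENNReal.ofReal_mul (hc x), ← ENNReal.ofReal_mul zero_le_two,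
    ← ENNReal.ofReal_mul zero_le_two, ← ENNReal.ofReal_mul zero_le_two,
    ← ENNReal.ofReal_add (mul_nonneg zero_le_two (mul_nonneg (hc x) (hc y))) (hc _),
    ← ENNReal.ofReal_add (add_nonneg (mul_nonneg zero_le_two (mul_nonneg (hc x) (hc y))) (hc _))
      (hc _),
    ← ENNReal.ofReal_add (mul_nonneg zero_le_two (hc _)) (mul_nonneg zero_le_two (hc _))]
  congr 1
  rw [Real.cos_add, Real.cos_sub]
  ring

theorem two_mul_lintegral_one_sub_cos (Λ : Measure E) (L L' : StrongDual ℝ E) :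
    2 * ∫⁻ w, ENNReal.ofReal (1 - Real.cos (L w)) * ENNReal.ofReal (1 - Real.cos (L' w)) ∂Λ +
        ∫⁻ w, ENNReal.ofReal (1 - Real.cos ((L + L') w)) ∂Λ +
        ∫⁻ w, ENNReal.ofReal (1 - Real.cos ((L - L') w)) ∂Λ =
      2 * ∫⁻ w, ENNReal.ofReal (1 - Real.cos (L w)) ∂Λ +
        2 * ∫⁻ w, ENNReal.ofReal (1 - Real.cos (L' w)) ∂Λ := by
  have m := measurable_ofReal_one_sub_cos (E := E)
  have mm : Measurable fun w => ENNReal.ofReal (1 - Real.cos (L w)) *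
      ENNReal.ofReal (1 - Real.cos (L' w)) := (m L).mul (m L')
  rw [← lintegral_const_mul _ mm, ← lintegral_const_mul _ (m L),
    ← lintegral_const_mul _ (m L'), ← lintegral_add_right _ (m _), ← lintegral_add_right _ (m _),
    ← lintegral_add_right _ ((m L').const_mul 2)]
  exact lintegral_congr fun w => ofReal_one_sub_cos_mul (L w) (L' w)

theorem isNegInvariant_withDensity_one_sub_cos (Λ : Measure E) [Λ.IsNegInvariant]
    (L : StrongDual ℝ E) :
    (Λ.withDensity fun w => ENNReal.ofReal (1 - Real.cos (L w))).IsNegInvariant := by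
  constructor
  refine Measure.ext_of_lintegral _ fun F hF => ?_
  have hF' : Measurable fun w => F (-w) := hF.comp measurable_neg
  rw [Measure.neg, lintegral_map hF measurable_neg,
    lintegral_withDensity_eq_lintegral_mul _ (measurable_ofReal_one_sub_cos L) hF',
    lintegral_withDensity_eq_lintegral_mul _ (measurable_ofReal_one_sub_cos L) hF,
    ← lintegral_neg_eq_self]
  simp

/-- The sine part is odd and integrates to 0. -/
theorem charFunDual_eq_of_isNegInvariant (m : Measure E) [IsFiniteMeasure m] [m.IsNegInvariant]
    (L : StrongDual ℝ E) :
    charFunDual m L = ((m.real Set.univ -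
      (∫⁻ w, ENNReal.ofReal (1 - Real.cos (L w)) ∂m).toReal : ℝ) : ℂ) := by
  have hcos : Integrable (fun w => Real.cos (L w)) m :=
    Integrable.of_bound (C := 1) (Measurable.aestronglyMeasurable (by fun_prop))
      (ae_of_all _ fun w => Real.abs_cos_le_one _)
  have hsin : Integrable (fun w => Real.sin (L w)) m :=
    Integrable.of_bound (C := 1) (Measurable.aestronglyMeasurable (by fun_prop))
      (ae_of_all _ fun w => Real.abs_sin_le_one _)
  have h1 : (∫⁻ w, ENNReal.ofReal (1 - Real.cos (L w)) ∂m).toReal =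
      m.real Set.univ - ∫ w, Real.cos (L w) ∂m := by
    rw [← integral_eq_lintegral_of_nonneg_ae
      (ae_of_all _ fun w => by simpa using Real.cos_le_one (L w))
      (Measurable.aestronglyMeasurable (by fun_prop)), integral_sub (integrable_const _) hcos]
    simp
  have h2 : ∫ w, Real.sin (L w) ∂m = 0 := by
    have := integral_neg_eq_self (fun w => Real.sin (L w)) m
    simp only [map_neg, Real.sin_neg, integral_neg] at this
    linarith
  have h3 : ∀ w, Complex.exp (L w * Complex.I) =
      ((Real.cos (L w) : ℝ) : ℂ) + ((Real.sin (L w) : ℝ) : ℂ) * Complex.I := fun w => by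
    rw [Complex.exp_mul_I]; push_cast; rfl
  rw [charFunDual_apply, h1, sub_sub_cancel]
  simp_rw [h3]
  rw [integral_add hcos.ofReal (hsin.ofReal.mul_const _), integral_mul_const, integral_complex_ofReal,
    integral_complex_ofReal, h2]
  simp

variable [SecondCountableTopology E] [CompleteSpace E]

/-- A symmetric measure `Λ` is determined on `{w | cos (L w) ≠ 1}` by the (finite) integrals
`∫ (1 - cos (L' w)) dΛ`. -/
theorem restrict_eq_of_lintegral_one_sub_cos_eq (Λ₁ Λ₂ : Measure E) [Λ₁.IsNegInvariant]
    [Λ₂.IsNegInvariant]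
    (hfin : ∀ L : StrongDual ℝ E, ∫⁻ w, ENNReal.ofReal (1 - Real.cos (L w)) ∂Λ₁ ≠ ∞)
    (heq : ∀ L : StrongDual ℝ E, ∫⁻ w, ENNReal.ofReal (1 - Real.cos (L w)) ∂Λ₁ =
      ∫⁻ w, ENNReal.ofReal (1 - Real.cos (L w)) ∂Λ₂) (L : StrongDual ℝ E) :
    Λ₁.restrict {w | Real.cos (L w) ≠ 1} = Λ₂.restrict {w | Real.cos (L w) ≠ 1} := by
  set d : E → ℝ≥0∞ := fun w => ENNReal.ofReal (1 - Real.cos (L w)) with hd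
  have hdm : Measurable d := measurable_ofReal_one_sub_cos L
  have hfin₂ : ∀ L : StrongDual ℝ E, ∫⁻ w, ENNReal.ofReal (1 - Real.cos (L w)) ∂Λ₂ ≠ ∞ :=
    fun L => heq L ▸ hfin L
  have := isFiniteMeasure_withDensity (hfin L)
  have := isFiniteMeasure_withDensity (hfin₂ L)
  have := isNegInvariant_withDensity_one_sub_cos Λ₁ L
  have := isNegInvariant_withDensity_one_sub_cos Λ₂ L
  -- The transform at `L'` involves `∫ (1 - cos L)` and `∫ (1 - cos L) (1 - cos L')`; the product
  -- identity reduces the latter to `L`, `L'` and `L ± L'`.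
  have hm : Λ₁.withDensity d = Λ₂.withDensity d := by
    refine Measure.ext_of_charFunDual (funext fun L' => ?_)
    rw [charFunDual_eq_of_isNegInvariant, charFunDual_eq_of_isNegInvariant, measureReal_def,
      measureReal_def, withDensity_apply _ MeasurableSet.univ,
      withDensity_apply _ MeasurableSet.univ, Measure.restrict_univ, Measure.restrict_univ, heq L,
      lintegral_withDensity_eq_lintegral_mul _ hdm (measurable_ofReal_one_sub_cos L'),
      lintegral_withDensity_eq_lintegral_mul _ hdm (measurable_ofReal_one_sub_cos L')]
    have h1 := two_mul_lintegral_one_sub_cos Λ₁ L L'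
    rw [heq L, heq L', heq (L + L'), heq (L - L'), ← two_mul_lintegral_one_sub_cos Λ₂ L L',
      ENNReal.add_left_inj (hfin₂ _), ENNReal.add_left_inj (hfin₂ _),
      ENNReal.mul_right_inj two_ne_zero ENNReal.ofNat_ne_top] at h1
    simp only [Pi.mul_apply, hd]
    rw [h1]
  have hU : MeasurableSet {w | Real.cos (L w) ≠ 1} :=
    (measurableSet_eq_fun (by fun_prop) measurable_const).compl
  -- Dividing by `d` undoes the weighting exactly where `d ≠ 0`; elsewhere `0 * ∞ = 0` produces the
  -- restriction.
  have key : ∀ Λ : Measure E, Λ.restrict {w | Real.cos (L w) ≠ 1} =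
      (Λ.withDensity d).withDensity fun w => (d w)⁻¹ := by
    intro Λ
    refine Measure.ext_of_lintegral _ fun F hF => ?_
    have hdi : Measurable fun w => (d w)⁻¹ := hdm.inv
    rw [lintegral_withDensity_eq_lintegral_mul _ hdi hF,
      lintegral_withDensity_eq_lintegral_mul _ hdm (hdi.mul hF), ← lintegral_indicator hU]
    refine lintegral_congr fun w => ?_
    by_cases h : Real.cos (L w) = 1
    · simp [h, hd]
    · have h0 : d w ≠ 0 := by
        have := lt_of_le_of_ne (Real.cos_le_one (L w)) h
        simpa [hd] using this
      rw [Set.indicator_of_mem (by exact h), Pi.mul_apply, Pi.mul_apply, ← mul_assoc,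
        ENNReal.mul_inv_cancel h0 ENNReal.ofReal_ne_top, one_mul]
  rw [key, key, hm]

end SymmetricMeasure

theorem exists_cos_div_ne_one {x : ℝ} (hx : x ≠ 0) : ∃ n : ℕ, Real.cos (x / (n + 1)) ≠ 1 := by
  obtain ⟨n, hn⟩ := exists_nat_gt |x|
  refine ⟨n, fun h => ?_⟩
  have hn1 : (0 : ℝ) < n + 1 := by positivity
  have hlt : |x / (n + 1)| < 1 := by
    rw [abs_div, abs_of_pos hn1, div_lt_one hn1]
    linarith
  obtain ⟨h1, h2⟩ := abs_lt.1 hlt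
  have := (Real.cos_eq_one_iff_of_lt_of_lt (by linarith [Real.pi_gt_three])
    (by linarith [Real.pi_gt_three])).1 h
  rcases div_eq_zero_iff.1 this with h | h
  · exact hx h
  · exact hn1.ne' h

theorem lintegral_eq_of_lintegral_one_sub_cos_eq (Λ₁ Λ₂ : Measure (ℝ × ℝ)) [Λ₁.IsNegInvariant]
    [Λ₂.IsNegInvariant]
    (hfin : ∀ L : StrongDual ℝ (ℝ × ℝ), ∫⁻ w, ENNReal.ofReal (1 - Real.cos (L w)) ∂Λ₁ ≠ ∞)
    (heq : ∀ L : StrongDual ℝ (ℝ × ℝ), ∫⁻ w, ENNReal.ofReal (1 - Real.cos (L w)) ∂Λ₁ =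
      ∫⁻ w, ENNReal.ofReal (1 - Real.cos (L w)) ∂Λ₂) {H : ℝ × ℝ → ℝ≥0∞} (h0 : H 0 = 0) :
    ∫⁻ w, H w ∂Λ₁ = ∫⁻ w, H w ∂Λ₂ := by
  -- Coordinate functionals divided by `n + 1`: at a nonzero point, some nonzero coordinate is
  -- eventually scaled into `(-1, 1)`, where the cosine equals 1 only at 0.
  set L : ℕ × Bool → StrongDual ℝ (ℝ × ℝ) := fun k =>
    ((k.1 : ℝ) + 1)⁻¹ • cond k.2 (ContinuousLinearMap.fst ℝ ℝ ℝ) (ContinuousLinearMap.snd ℝ ℝ ℝ)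
  have hU : (⋃ k, {w | Real.cos (L k w) ≠ 1}) = {(0 : ℝ × ℝ)}ᶜ := by
    ext w
    simp only [Set.mem_iUnion, Set.mem_ofPred_eq, Set.mem_compl_iff, Set.mem_singleton_iff]
    constructor
    · rintro ⟨k, hk⟩ rfl
      simp at hk
    · intro hw
      by_cases h1 : w.1 = 0
      · have h2 : w.2 ≠ 0 := fun h2 => hw (Prod.ext h1 h2)
        obtain ⟨n, hn⟩ := exists_cos_div_ne_one h2
        exact ⟨(n, false), by simpa [L, div_eq_inv_mul] using hn⟩
      · obtain ⟨n, hn⟩ := exists_cos_div_ne_one h1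
        exact ⟨(n, true), by simpa [L, div_eq_inv_mul] using hn⟩
  have hres : Λ₁.restrict {0}ᶜ = Λ₂.restrict {0}ᶜ := by
    rw [← hU]
    exact Measure.restrict_iUnion_congr.2 fun k =>
      restrict_eq_of_lintegral_one_sub_cos_eq Λ₁ Λ₂ hfin heq (L k)
  have key : ∀ Λ : Measure (ℝ × ℝ), ∫⁻ w, H w ∂Λ = ∫⁻ w in {0}ᶜ, H w ∂Λ := by
    intro Λ
    rw [← lintegral_indicator (measurableSet_singleton _).compl]
    refine lintegral_congr fun w => ?_
    by_cases hw : w = 0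
    · simp [hw, h0]
    · rw [Set.indicator_of_mem (by simpa using hw)]
  rw [key Λ₁, key Λ₂, hres]

/-! ### The Lévy measure attached to a measure on the plane -/

/-- The measure `|r| ^ (-1 - α) dr` on the real line. -/
noncomputable def radialMeasure (α : ℝ) : Measure ℝ :=
  volume.withDensity fun r => ENNReal.ofReal (|r| ^ (-1 - α))

instance (α : ℝ) : SFinite (radialMeasure α) := by
  unfold radialMeasure; infer_instance

theorem measurable_ofReal_abs_rpow (p : ℝ) : Measurable fun r : ℝ => ENNReal.ofReal (|r| ^ p) := by
  fun_prop

theorem lintegral_radialMeasure (α : ℝ) {F : ℝ → ℝ≥0∞} (hF : Measurable F) :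
    ∫⁻ r, F r ∂radialMeasure α = ∫⁻ r, ENNReal.ofReal (|r| ^ (-1 - α)) * F r :=
  lintegral_withDensity_eq_lintegral_mul _ (measurable_ofReal_abs_rpow _) hF

/-- Change of variables: the Jacobian `|x|⁻¹` and the density factor `|x| ^ (1 + α)` combine to `|x|
^ α`. The case `x = -1` gives the symmetry of the Lévy measure. -/
theorem lintegral_radialMeasure_comp_mul (α : ℝ) {F : ℝ → ℝ≥0∞} (hF : Measurable F) {x : ℝ}
    (hx : x ≠ 0) :
    ∫⁻ r, F (x * r) ∂radialMeasure α = ‖x‖ₑ ^ α * ∫⁻ r, F r ∂radialMeasure α := by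
  have hx' : 0 < |x| := abs_pos.2 hx
  have hm : Measurable fun r : ℝ => ENNReal.ofReal (|r| ^ (-1 - α)) * F r :=
    (measurable_ofReal_abs_rpow _).mul hF
  have h1 : ∀ r : ℝ, ENNReal.ofReal (|r| ^ (-1 - α)) * F (x * r) =
      ENNReal.ofReal (|x| ^ (1 + α)) * (ENNReal.ofReal (|x * r| ^ (-1 - α)) * F (x * r)) := by
    intro r
    rw [← mul_assoc, ← ENNReal.ofReal_mul (by positivity), abs_mul,
      Real.mul_rpow hx'.le (abs_nonneg r), ← mul_assoc, ← Real.rpow_add hx']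
    simp
  have hF' : Measurable fun r => F (x * r) := hF.comp (measurable_const_mul x)
  rw [lintegral_radialMeasure α hF', lintegral_radialMeasure α hF]
  simp_rw [h1]
  have hmx : Measurable fun r : ℝ => ENNReal.ofReal (|x * r| ^ (-1 - α)) * F (x * r) :=
    hm.comp (measurable_const_mul x)
  rw [lintegral_const_mul _ hmx,
    ← lintegral_map hm (measurable_const_mul x), Real.map_volume_mul_left hx,
    lintegral_smul_measure, smul_eq_mul, ← mul_assoc, ← ENNReal.ofReal_mul (by positivity)]
  congr 1
  rw [abs_inv, ← Real.rpow_neg_one |x|, ← Real.rpow_add hx', ← Real.norm_eq_abs,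
    ← ENNReal.ofReal_rpow_of_pos (by simpa using hx'), ofReal_norm]
  congr 1
  ring

/-- Near 0 the integrand is at most `r ^ (1 - α)`, integrable because `α < 2`; at infinity it is at
most `2 r ^ (-1 - α)`, integrable because `α > 0`. Evenness handles the negative half-line. -/
theorem lintegral_radialMeasure_one_sub_cos_ne_top {α : ℝ} (hα0 : 0 < α) (hα2 : α < 2) :
    ∫⁻ r, ENNReal.ofReal (1 - Real.cos r) ∂radialMeasure α ≠ ∞ := by
  set u : ℝ → ℝ := fun r => |r| ^ (-1 - α) * (1 - Real.cos r) with hu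
  have hum : Measurable u := by fun_prop
  have hpos : ∀ r, 0 ≤ u r := fun r =>
    mul_nonneg (by positivity) (by linarith [Real.cos_le_one r])
  rw [lintegral_radialMeasure α (by fun_prop)]
  have e : ∀ r : ℝ, ENNReal.ofReal (|r| ^ (-1 - α)) * ENNReal.ofReal (1 - Real.cos r) =
      ENNReal.ofReal (u r) := fun r => (ENNReal.ofReal_mul (by positivity)).symm
  simp_rw [e]
  suffices h : Integrable u by
    exact (h.lintegral_lt_top).ne
  have hIoi : IntegrableOn u (Set.Ioi 0) := by
    rw [← Set.Ioc_union_Ioi_eq_Ioi zero_le_one]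
    refine IntegrableOn.union ?_ ?_
    · have h1 : IntegrableOn (fun r : ℝ => r ^ (1 - α)) (Set.Ioc 0 1) := by
        rw [← intervalIntegrable_iff_integrableOn_Ioc_of_le zero_le_one]
        exact intervalIntegral.intervalIntegrable_rpow' (by linarith)
      refine Integrable.mono' h1 hum.aestronglyMeasurable ?_
      filter_upwards [ae_restrict_mem measurableSet_Ioc] with r hr
      rw [Real.norm_of_nonneg (hpos r), hu]
      have hr0 : 0 < r := hr.1
      have : r ^ (1 - α) = r ^ (-1 - α) * r ^ 2 := by
        rw [← Real.rpow_natCast, ← Real.rpow_add hr0]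
        congr 1
        push_cast
        ring
      rw [this]
      simp only [abs_of_pos hr0]
      gcongr
      nlinarith [Real.one_sub_sq_div_two_le_cos (x := r)]
    · have h1 : IntegrableOn (fun r : ℝ => r ^ (-1 - α) * 2) (Set.Ioi 1) :=
        (integrableOn_Ioi_rpow_of_lt (by linarith) one_pos).mul_const 2
      refine Integrable.mono' h1 hum.aestronglyMeasurable ?_
      filter_upwards [ae_restrict_mem measurableSet_Ioi] with r hr
      have hr0 : 0 < r := one_pos.trans hr
      rw [Real.norm_of_nonneg (hpos r), hu]
      simp only [abs_of_pos hr0]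
      gcongr
      linarith [Real.neg_one_le_cos r]
  have hIio : IntegrableOn u (Set.Iio 0) := by
    have := hIoi.comp_neg
    simpa [hu] using this
  rw [← integrableOn_univ, ← Set.Iio_union_Ici (a := (0 : ℝ))]
  exact hIio.union ((integrableOn_Ici_iff_integrableOn_Ioi).2 hIoi)

theorem lintegral_radialMeasure_one_sub_cos_mul {α : ℝ} (hα0 : 0 < α) (x : ℝ) :
    ∫⁻ r, ENNReal.ofReal (1 - Real.cos (r * x)) ∂radialMeasure α =
      ‖x‖ₑ ^ α * ∫⁻ r, ENNReal.ofReal (1 - Real.cos r) ∂radialMeasure α := by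
  rcases eq_or_ne x 0 with rfl | hx
  · simp [ENNReal.zero_rpow_of_pos hα0]
  · simp_rw [mul_comm _ x]
    exact lintegral_radialMeasure_comp_mul α (F := fun r => ENNReal.ofReal (1 - Real.cos r))
      (by fun_prop) hx

/-- The image of `ν ⊗ |r| ^ (-1 - α) dr` under `(z, r) ↦ r • z`. -/
noncomputable def levyMeasure (α : ℝ) (ν : Measure (ℝ × ℝ)) : Measure (ℝ × ℝ) :=
  (ν.prod (radialMeasure α)).map fun p => p.2 • p.1

theorem lintegral_levyMeasure (α : ℝ) (ν : Measure (ℝ × ℝ)) {H : ℝ × ℝ → ℝ≥0∞}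
    (hH : Measurable H) :
    ∫⁻ w, H w ∂levyMeasure α ν = ∫⁻ z, ∫⁻ r, H (r • z) ∂radialMeasure α ∂ν := by
  have hm : Measurable fun p : (ℝ × ℝ) × ℝ => p.2 • p.1 := by fun_prop
  rw [levyMeasure, lintegral_map hH hm, lintegral_prod]
  exact (hH.comp hm).aemeasurable

instance (α : ℝ) (ν : Measure (ℝ × ℝ)) : (levyMeasure α ν).IsNegInvariant := by
  constructor
  refine Measure.ext_of_lintegral _ fun F hF => ?_
  have hF' : Measurable fun w => F (-w) := hF.comp measurable_neg
  rw [Measure.neg, lintegral_map hF measurable_neg, lintegral_levyMeasure α ν hF', lintegral_levyMeasure α ν hF]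
  refine lintegral_congr fun z => ?_
  have := lintegral_radialMeasure_comp_mul α (F := fun r => F (r • z))
    (hF.comp (by fun_prop)) (x := -1) (by simp)
  simpa using this

theorem lintegral_levyMeasure_one_sub_cos {α : ℝ} (hα0 : 0 < α) (ν : Measure (ℝ × ℝ))
    (L : StrongDual ℝ (ℝ × ℝ)) :
    ∫⁻ w, ENNReal.ofReal (1 - Real.cos (L w)) ∂levyMeasure α ν =
      (∫⁻ z, ‖L z‖ₑ ^ α ∂ν) * ∫⁻ r, ENNReal.ofReal (1 - Real.cos r) ∂radialMeasure α := by
  rw [lintegral_levyMeasure α ν (measurable_ofReal_one_sub_cos L),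
    ← lintegral_mul_const _ (by fun_prop)]
  simp_rw [map_smul, smul_eq_mul, lintegral_radialMeasure_one_sub_cos_mul hα0]

/-- The powers of `|r|` combine to `|r|⁻¹`, so the integral is `2 log 2`; crude bounds suffice for
cancelling it later. -/
theorem lintegral_radialMeasure_annulus (α : ℝ) :
    ∫⁻ r, ‖r‖ₑ ^ α * {r : ℝ | 1 ≤ |r| ∧ |r| ≤ 2}.indicator 1 r ∂radialMeasure α ≠ 0 ∧
    ∫⁻ r, ‖r‖ₑ ^ α * {r : ℝ | 1 ≤ |r| ∧ |r| ≤ 2}.indicator 1 r ∂radialMeasure α ≠ ∞ := by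
  set A : Set ℝ := {r : ℝ | 1 ≤ |r| ∧ |r| ≤ 2} with hA
  have hAm : MeasurableSet A := (measurableSet_le measurable_const measurable_id.abs).inter
    (measurableSet_le measurable_id.abs measurable_const)
  have hform : ∫⁻ r, ‖r‖ₑ ^ α * A.indicator 1 r ∂radialMeasure α =
      ∫⁻ r in A, ENNReal.ofReal |r|⁻¹ := by
    have hm1 : Measurable (A.indicator (1 : ℝ → ℝ≥0∞)) := measurable_one.indicator hAm
    rw [lintegral_radialMeasure α (by fun_prop), ← lintegral_indicator hAm]
    refine lintegral_congr fun r => ?_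
    by_cases hr : r ∈ A
    · have hr0 : 0 < |r| := one_pos.trans_le hr.1
      rw [Set.indicator_of_mem hr, Set.indicator_of_mem hr, Pi.one_apply, mul_one,
        ← ofReal_norm, Real.norm_eq_abs, ENNReal.ofReal_rpow_of_pos hr0,
        ← ENNReal.ofReal_mul (by positivity), ← Real.rpow_add hr0, ← Real.rpow_neg_one]
      congr 2
      ring
    · simp [hr]
  rw [hform]
  constructor
  · have h1 : ENNReal.ofReal 2⁻¹ * volume A ≤ ∫⁻ r in A, ENNReal.ofReal |r|⁻¹ := by
      rw [← setLIntegral_const]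
      refine setLIntegral_mono (by fun_prop) fun r hr => ?_
      have hr0 : 0 < |r| := one_pos.trans_le hr.1
      exact ENNReal.ofReal_le_ofReal (inv_anti₀ hr0 hr.2)
    have h2 : (1 : ℝ≥0∞) ≤ volume A := by
      have : Set.Icc (1 : ℝ) 2 ⊆ A := fun r hr => by
        rw [hA, Set.mem_ofPred_eq, abs_of_pos (one_pos.trans_le hr.1)]
        exact hr
      refine le_trans ?_ (measure_mono this)
      rw [Real.volume_Icc]
      norm_num
    refine (lt_of_lt_of_le ?_ h1).ne'
    exact ENNReal.mul_pos (by simp) (one_pos.trans_le h2).ne'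
  · have h1 : ∫⁻ r in A, ENNReal.ofReal |r|⁻¹ ≤ 1 * volume A := by
      rw [← setLIntegral_const]
      refine setLIntegral_mono measurable_const fun r hr => ?_
      rw [← ENNReal.ofReal_one]
      exact ENNReal.ofReal_le_ofReal (inv_le_one_of_one_le₀ hr.1)
    have h2 : volume A ≤ volume (Set.Icc (-2 : ℝ) 2) :=
      measure_mono fun r hr => abs_le.1 hr.2
    rw [Real.volume_Icc] at h2
    exact (h1.trans_lt (by rw [one_mul]; exact h2.trans_lt ENNReal.ofReal_lt_top)).ne

/-! ### Homogeneous functionals depend only on the scale function -/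

/-- A measure on the plane is determined by its scale function `(a, b) ↦ ∫ |a x + b y| ^ α` on the
functions that are absolutely homogeneous of degree `α`. -/
theorem lintegral_homogeneous_eq {α : ℝ} (hα0 : 0 < α) (hα2 : α < 2) (ν₁ ν₂ : Measure (ℝ × ℝ))
    (hfin : ∀ a b : ℝ, ∫⁻ z, ‖a * z.1 + b * z.2‖ₑ ^ α ∂ν₁ ≠ ∞)
    (heq : ∀ a b : ℝ, ∫⁻ z, ‖a * z.1 + b * z.2‖ₑ ^ α ∂ν₁ = ∫⁻ z, ‖a * z.1 + b * z.2‖ₑ ^ α ∂ν₂)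
    {h : ℝ × ℝ → ℝ≥0∞} (hm : Measurable h) (h0 : h 0 = 0)
    (hh : ∀ (r : ℝ) (z : ℝ × ℝ), r ≠ 0 → h (r • z) = ‖r‖ₑ ^ α * h z) :
    ∫⁻ z, h z ∂ν₁ = ∫⁻ z, h z ∂ν₂ := by
  have hL : ∀ (L : StrongDual ℝ (ℝ × ℝ)) (z : ℝ × ℝ), L z = L (1, 0) * z.1 + L (0, 1) * z.2 := by
    intro L z
    have : z = z.1 • ((1, 0) : ℝ × ℝ) + z.2 • ((0, 1) : ℝ × ℝ) := by ext <;> simp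
    conv_lhs => rw [this, map_add, map_smul, map_smul, smul_eq_mul, smul_eq_mul]
    ring
  set A : Set ℝ := {r : ℝ | 1 ≤ |r| ∧ |r| ≤ 2} with hA
  have hAm : MeasurableSet A := (measurableSet_le measurable_const measurable_id.abs).inter
    (measurableSet_le measurable_id.abs measurable_const)
  have hm1 : Measurable (A.indicator (1 : ℝ → ℝ≥0∞)) := measurable_one.indicator hAm
  set K := ∫⁻ r, ‖r‖ₑ ^ α * A.indicator 1 r ∂radialMeasure α with hK
  set H : ℝ × ℝ → ℝ≥0∞ := fun w => h w * A.indicator 1 ‖w‖ with hH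
  have hHm : Measurable H := hm.mul (hm1.comp measurable_norm)
  -- Cutting `h` off to an annulus makes the ray through each `z ≠ 0` contribute `h z * K`, whatever
  -- the size of `z`.
  have key : ∀ ν : Measure (ℝ × ℝ), ∫⁻ w, H w ∂levyMeasure α ν = (∫⁻ z, h z ∂ν) * K := by
    intro ν
    rw [lintegral_levyMeasure α ν hHm, ← lintegral_mul_const _ hm]
    refine lintegral_congr fun z => ?_
    rcases eq_or_ne z 0 with rfl | hz
    · simp [hH, h0]
    · have hz' : ‖z‖ ≠ 0 := norm_ne_zero_iff.2 hz
      -- The factor `‖z‖ₑ ^ α`, later cancelled, turns the integrand into a function of `‖z‖ * r`,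
      -- ready for the scaling rule of `radialMeasure`.
      have e : ∀ r : ℝ, ‖z‖ₑ ^ α * H (r • z) =
          h z * (‖‖z‖ * r‖ₑ ^ α * A.indicator 1 (‖z‖ * r)) := by
        intro r
        rcases eq_or_ne r 0 with rfl | hr
        · simp [hH, hA, h0]
        · have hind : A.indicator (1 : ℝ → ℝ≥0∞) ‖r • z‖ = A.indicator 1 (‖z‖ * r) := by
            simp only [Set.indicator_apply, hA, Set.mem_ofPred_eq, norm_smul, abs_mul, abs_norm,
              Real.norm_eq_abs, abs_abs, mul_comm, Pi.one_apply]
          simp only [hH]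
          rw [hh r z hr, hind, enorm_mul, ENNReal.mul_rpow_of_nonneg _ _ hα0.le, enorm_norm]
          ring
      have hfm : Measurable fun r : ℝ => ‖r‖ₑ ^ α * A.indicator 1 r := by fun_prop
      have h1 : ‖z‖ₑ ^ α * ∫⁻ r, H (r • z) ∂radialMeasure α = ‖z‖ₑ ^ α * (h z * K) := by
        have hHr : Measurable fun r : ℝ => H (r • z) := hHm.comp (by fun_prop)
        rw [← lintegral_const_mul _ hHr]
        have hfz : Measurable fun r : ℝ => ‖‖z‖ * r‖ₑ ^ α * A.indicator 1 (‖z‖ * r) :=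
          hfm.comp (measurable_const_mul _)
        simp_rw [e]
        rw [lintegral_const_mul _ hfz,
          lintegral_radialMeasure_comp_mul α hfm hz', enorm_norm, ← hK]
        ring
      have hne : ‖z‖ₑ ^ α ≠ 0 := by simp [ENNReal.rpow_eq_zero_iff, hz]
      exact (ENNReal.mul_right_inj hne (ENNReal.rpow_ne_top_of_nonneg hα0.le enorm_ne_top)).1 h1
  have hΛ : ∫⁻ w, H w ∂levyMeasure α ν₁ = ∫⁻ w, H w ∂levyMeasure α ν₂ := by
    refine lintegral_eq_of_lintegral_one_sub_cos_eq _ _ (fun L => ?_) (fun L => ?_) (by simp [hH, h0])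
    · rw [lintegral_levyMeasure_one_sub_cos hα0]
      simp_rw [fun z => congrArg (fun x : ℝ => ‖x‖ₑ ^ α) (hL L z)]
      exact ENNReal.mul_ne_top (hfin _ _) (lintegral_radialMeasure_one_sub_cos_ne_top hα0 hα2)
    · rw [lintegral_levyMeasure_one_sub_cos hα0, lintegral_levyMeasure_one_sub_cos hα0]
      simp_rw [fun z => congrArg (fun x : ℝ => ‖x‖ₑ ^ α) (hL L z)]
      rw [heq]
  rw [key, key] at hΛ
  obtain ⟨hK0, hKt⟩ := lintegral_radialMeasure_annulus α
  exact (ENNReal.mul_left_inj hK0 hKt).1 hΛ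

/-- The functionals `∫ h(f, g) dμ`, with `h` absolutely homogeneous of degree `α`, depend on
`(f, g, μ)` only through the scale function of the stable vector it represents. -/
theorem IsIntegralRepresentation.lintegral_homogeneous_eq {Ω : Type*} [MeasurableSpace Ω]
    {S₁ S₂ : Type*} [MeasurableSpace S₁] [MeasurableSpace S₂] {α : ℝ} (hα0 : 0 < α) (hα2 : α < 2)
    {P : Measure Ω} {ξ η : Ω → ℝ}
    {f₁ g₁ : S₁ → ℝ} {μ₁ : Measure S₁} {f₂ g₂ : S₂ → ℝ} {μ₂ : Measure S₂}
    (h₁ : IsIntegralRepresentation α P ξ η f₁ g₁ μ₁)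
    (h₂ : IsIntegralRepresentation α P ξ η f₂ g₂ μ₂)
    {h : ℝ × ℝ → ℝ≥0∞} (hm : Measurable h) (h0 : h 0 = 0)
    (hh : ∀ (r : ℝ) (z : ℝ × ℝ), r ≠ 0 → h (r • z) = ‖r‖ₑ ^ α * h z) :
    ∫⁻ s, h (f₁ s, g₁ s) ∂μ₁ = ∫⁻ s, h (f₂ s, g₂ s) ∂μ₂ := by
  have m₁ : AEMeasurable (fun s => (f₁ s, g₁ s)) μ₁ :=
    h₁.1.1.aemeasurable.prodMk h₁.2.1.1.aemeasurable
  have m₂ : AEMeasurable (fun s => (f₂ s, g₂ s)) μ₂ :=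
    h₂.1.1.aemeasurable.prodMk h₂.2.1.1.aemeasurable
  have mL : ∀ a b : ℝ, Measurable fun z : ℝ × ℝ => ‖a * z.1 + b * z.2‖ₑ ^ α := by
    intro a b
    fun_prop
  have e := _root_.lintegral_homogeneous_eq hα0 hα2 (μ₁.map fun s => (f₁ s, g₁ s))
    (μ₂.map fun s => (f₂ s, g₂ s))
    (fun a b => by
      rw [lintegral_map' (mL a b).aemeasurable m₁]
      exact lintegral_enorm_add_rpow_ne_top hα0 h₁.1 h₁.2.1 a b)
    (fun a b => by
      rw [lintegral_map' (mL a b).aemeasurable m₁, lintegral_map' (mL a b).aemeasurable m₂]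
      exact h₁.lintegral_eq hα0 h₂ a b) hm h0 hh
  rwa [lintegral_map' hm.aemeasurable m₁, lintegral_map' hm.aemeasurable m₂] at e

/-! ### Homogeneity of the three integrands -/

/-- Valid even when `x = 0` and `α < 1`, where a factor is `∞`: since `r ≠ 0`, the scalar `‖r‖ₑ ^ (α
- 1)` is finite and positive. -/
theorem enorm_rpow_sub_one_mul_homogeneous (α : ℝ) {r : ℝ} (hr : r ≠ 0) (x y : ℝ) :
    ‖r * x‖ₑ ^ (α - 1) * ‖r * y‖ₑ = ‖r‖ₑ ^ α * (‖x‖ₑ ^ (α - 1) * ‖y‖ₑ) := by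
  have h : ‖r‖ₑ ^ α = ‖r‖ₑ ^ (α - 1) * ‖r‖ₑ := by
    conv_lhs => rw [show α = (α - 1) + 1 by ring]
    rw [ENNReal.rpow_add _ _ (by simpa using hr) enorm_ne_top, ENNReal.rpow_one]
  rw [enorm_mul, enorm_mul, ENNReal.mul_rpow_of_ne_top enorm_ne_top enorm_ne_top, h]
  ring

theorem proposition2p1 (α : ℝ) (hα0 : 0 < α) (hα2 : α < 2)
    {Ω : Type u₀} [MeasurableSpace Ω] (P : Measure Ω) [IsProbabilityMeasure P] (ξ η : Ω → ℝ)
    {S₁ : Type u₁} [MeasurableSpace S₁] (f₁ g₁ : S₁ → ℝ) (μ₁ : Measure S₁)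
    {S₂ : Type u₂} [MeasurableSpace S₂] (f₂ g₂ : S₂ → ℝ) (μ₂ : Measure S₂)
    (h₁ : IsIntegralRepresentation.{u₀, u₁, w₁} α P ξ η f₁ g₁ μ₁)
    (h₂ : IsIntegralRepresentation.{u₀, u₂, w₂} α P ξ η f₂ g₂ μ₂) :
    depOneStar α f₁ g₁ μ₁ = depOneStar α f₂ g₂ μ₂ ∧
    depOne α f₁ g₁ μ₁ = depOne α f₂ g₂ μ₂ ∧
    depTwo α f₁ g₁ μ₁ = depTwo α f₂ g₂ μ₂ := by
  -- At the origin the integrand is 0 for every `α`, by `∞ * 0 = 0` when `α < 1`.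
  have e₁ : depOneStar α f₁ g₁ μ₁ = depOneStar α f₂ g₂ μ₂ :=
    h₁.lintegral_homogeneous_eq hα0 hα2 h₂ (h := fun z => ‖z.1‖ₑ ^ (α - 1) * ‖z.2‖ₑ)
      (by fun_prop) (by simp) fun r z hr => enorm_rpow_sub_one_mul_homogeneous α hr z.1 z.2
  have e₂ : depOneStar α g₁ f₁ μ₁ = depOneStar α g₂ f₂ μ₂ :=
    h₁.lintegral_homogeneous_eq hα0 hα2 h₂ (h := fun z => ‖z.2‖ₑ ^ (α - 1) * ‖z.1‖ₑ)
      (by fun_prop) (by simp) fun r z hr => enorm_rpow_sub_one_mul_homogeneous α hr z.2 z.1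
  refine ⟨e₁, by rw [depOne, depOne, e₁, e₂], ?_⟩
  refine h₁.lintegral_homogeneous_eq hα0 hα2 h₂ (h := fun z => ‖z.1 * z.2‖ₑ ^ (α / 2))
    (by fun_prop) (by simp [hα0]) fun r z _ => ?_
  have hr : ‖r‖ₑ ^ α = ‖r‖ₑ ^ (α / 2) * ‖r‖ₑ ^ (α / 2) := by
    rw [← ENNReal.rpow_add_of_nonneg _ _ (by positivity) (by positivity), add_halves]
  have hα : 0 ≤ α / 2 := by positivity
  simp only [Prod.smul_fst, Prod.smul_snd, smul_eq_mul, enorm_mul,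
    ENNReal.mul_rpow_of_nonneg _ _ hα, hr]
  ring
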